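/- A graphon is a symmetric Borel measurable function $W:[0,1]^2\to[0,1]$; it is random-free if $W(x,y)\in\{0,1\}$ for almost every $(x,y)\in[0,1]^2$. The $W$-random graph $G(\infty,W)$ is the random graph with vertex set $\mathbb{N}$ obtained by taking independent random variables $X_0,X_1,X_2,\dots$ uniformly distributed on $[0,1]$ and, conditionally on these, joining each pair $i<j$ by an edge independently with probability $W(X_i,X_j)$ (there are no loops, and adjacency is symmetric). A probability measure on the space of graphs with vertex set $\mathbb{N}$ is concentrated on a countably infinite graph $M$ if it assigns measure $1$ to the set of graphs with vertex set $\mathbb{N}$ that are isomorphic to $M$. Let $M$ be a countably infinite graph. Suppose that there is a graphon $W$ such that the distribution of $G(\infty,W)$ is concentrated on $M$. Then there is a random-free graphon $W'$ such that the distribution of $G(\infty,W')$ is also concentrated on $M$. -/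

import Mathlib

open MeasureTheory unitInterval

/-- A graphon: a symmetric Borel measurable function `[0,1]² → [0,1]`. -/
structure Graphon where
  toFun : I → I → I
  symm' : ∀ x y, toFun x y = toFun y x
  measurable' : Measurable (Function.uncurry toFun)

namespace Graphon

/-- A graphon is random-free if its value at `(x, y)` is `0` or `1` for a.e. `(x, y) ∈ [0,1]²`. -/
def IsRandomFree (W : Graphon) : Prop :=
  ∀ᵐ p : I × I, W.toFun p.1 p.2 = 0 ∨ W.toFun p.1 p.2 = 1

/-- The graph on `ℕ` determined by vertex labels `x i` and edge labels `u {i, j}`: distinct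
vertices `i` and `j` are joined exactly when `u {i, j} < W (x i) (x j)`. -/
def sampleGraph (W : Graphon) (ω : (ℕ → I) × (Sym2 ℕ → I)) : SimpleGraph ℕ where
  Adj i j := i ≠ j ∧ ω.2 s(i, j) < W.toFun (ω.1 i) (ω.1 j)
  symm := ⟨fun i j h => ⟨h.1.symm, by rw [Sym2.eq_swap, W.symm']; exact h.2⟩⟩
  loopless := ⟨fun _ h => h.1 rfl⟩

theorem measurable_sampleGraph (W : Graphon) : Measurable W.sampleGraph := by
  refine measurable_comap_iff.2 (measurable_pi_iff.2 fun i => measurable_pi_iff.2 fun j => ?_)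
  refine measurable_to_prop ?_
  have h : MeasurableSet {ω : (ℕ → I) × (Sym2 ℕ → I) |
      i ≠ j ∧ ω.2 s(i, j) < W.toFun (ω.1 i) (ω.1 j)} := by
    have h1 : Measurable fun ω : (ℕ → I) × (Sym2 ℕ → I) => ω.2 s(i, j) := by fun_prop
    have h2 : Measurable fun ω : (ℕ → I) × (Sym2 ℕ → I) => W.toFun (ω.1 i) (ω.1 j) :=
      W.measurable'.comp (f := fun ω : (ℕ → I) × (Sym2 ℕ → I) => (ω.1 i, ω.1 j)) (by fun_prop)
    have h3 := measurableSet_lt h1 h2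
    exact (MeasurableSet.const _).inter h3
  convert h using 1
  ext ω
  simp [sampleGraph]

/-- The distribution of the `W`-random graph `G(∞, W)`: the vertex labels and the edge labels are
all independent and uniform on `[0,1]`, so that, given the vertex labels `x`, the pairs `i < j` are
joined independently of each other, with probability `W (x i) (x j)`. -/
noncomputable def randomGraph (W : Graphon) : Measure (SimpleGraph ℕ) :=
  ((Measure.infinitePi fun _ : ℕ => (volume : Measure I)).prod
    (Measure.infinitePi fun _ : Sym2 ℕ => (volume : Measure I))).map W.sampleGraph

instance (W : Graphon) : IsProbabilityMeasure W.randomGraph :=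
  Measure.isProbabilityMeasure_map W.measurable_sampleGraph.aemeasurable

end Graphon

/-- A measure on the space of graphs with vertex set `ℕ` is concentrated on the graph `M` if it
gives measure one to the isomorphism class of `M`, which is a Borel set for countable `M`. -/
def IsConcentratedOn {V : Type*} (μ : Measure (SimpleGraph ℕ)) (M : SimpleGraph V) : Prop :=
  μ {N : SimpleGraph ℕ | Nonempty (N ≃g M)} = 1

/-! The bridge is trivial definable closure: outside a finite set `A`, every vertex has an infinite
orbit under the pointwise stabilizer of `A`.

Necessity (`Graphon.exists_iso_fix_apply_notMem`): by exchangeability, the events that some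
isomorphism to `M` fixes `A` and sends `j` to `a` have the same positive probability for all `j ∉
A`. If the orbit of `a` lay in a finite `B`, at most `B.card` of them could hold at once,
contradicting double counting.

Sufficiency (`HasTrivialDCL.exists_isRandomFree`): trivial closure lets finite sets of vertices be
duplicated elementarily. A random point is a walker in `M` that repeatedly jumps to duplicates by
coin tosses. Walkers separate almost surely, and then the adjacency of their positions never
changes; the limiting adjacency is a 0/1-valued graphon. A back-and-forth argument
(`DuplicationTower.nonempty_iso`) identifies its samples with `M`. -/

/-! ### Universal measurability of analytic sets and of isomorphism events -/

theorem isCompact_setOf_forall_le (b : ℕ → ℕ) : IsCompact {x : ℕ → ℕ | ∀ i, x i ≤ b i} := by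
  have : {x : ℕ → ℕ | ∀ i, x i ≤ b i} = Set.univ.pi fun i => Set.Iic (b i) := by
    ext
    simp only [Set.mem_ofPred_eq, Set.mem_pi, Set.mem_univ, true_imp_iff, Set.mem_Iic]
  rw [this]
  exact isCompact_univ_pi fun i => (Set.finite_Iic _).isCompact

theorem exists_image_box_subset_of_isOpen {X : Type*} [TopologicalSpace X] {f : (ℕ → ℕ) → X}
    (hf : Continuous f) (b : ℕ → ℕ) {U : Set X} (hU : IsOpen U)
    (h : f '' {x | ∀ i, x i ≤ b i} ⊆ U) :
    ∃ k, f '' {x | ∀ i < k, x i ≤ b i} ⊆ U := by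
  by_contra! hcon
  simp only [Set.image_subset_iff, Set.not_subset] at hcon h
  choose x hx hxU using hcon
  -- Truncation puts `x k` in the compact box and leaves coordinates below `k` unchanged, so the
  -- original subsequence has the same limit.
  obtain ⟨y, hy, φ, hφ, hlim⟩ :=
    (isCompact_setOf_forall_le b).tendsto_subseq (x := fun k i => min (x k i) (b i)) (fun k i => min_le_right _ _)
  have hlim' : Filter.Tendsto (x ∘ φ) Filter.atTop (nhds y) := by
    rw [tendsto_pi_nhds] at hlim ⊢
    intro i
    refine (hlim i).congr' ?_
    filter_upwards [hφ.tendsto_atTop.eventually_gt_atTop i] with k hk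
    exact min_eq_left (hx (φ k) i hk)
  obtain ⟨k, hk⟩ := (hlim'.eventually ((hU.preimage hf).mem_nhds (h hy))).exists
  exact hxU _ hk

/-- Choquet's capacity argument: bound the coordinates one at a time, keeping the measure of the
image above `c`. Continuity from below needs no measurability of the images; the intersection of the
bounds is a compact box. -/
theorem exists_isCompact_subset_range_lt_measure {X : Type*} [TopologicalSpace X]
    [MeasurableSpace X] {f : (ℕ → ℕ) → X} (hf : Continuous f) (μ : Measure X) [μ.OuterRegular]
    {c : ENNReal} (hc : c < μ (Set.range f)) :
    ∃ K ⊆ Set.range f, IsCompact K ∧ c ≤ μ K := by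
  have step : ∀ (k : ℕ) (A : Set (ℕ → ℕ)), c < μ (f '' A) →
      ∃ m, c < μ (f '' (A ∩ {x | x k ≤ m})) := by
    intro k A hA
    have hmono : Monotone fun m : ℕ => f '' (A ∩ {x | x k ≤ m}) := fun m n hmn =>
      Set.image_mono (Set.inter_subset_inter_right _ fun x (hx : x k ≤ m) => hx.trans hmn)
    have hU : f '' A = ⋃ m : ℕ, f '' (A ∩ {x | x k ≤ m}) := by
      rw [← Set.image_iUnion, ← Set.inter_iUnion]
      congr 1
      symm
      exact Set.inter_eq_left.2 fun x _ => Set.mem_iUnion.2 ⟨x k, le_refl (x k)⟩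
    rw [hU, hmono.measure_iUnion] at hA
    exact lt_iSup_iff.1 hA
  choose! m hm using step
  let A : ℕ → Set (ℕ → ℕ) := fun k => Nat.rec Set.univ (fun k B => B ∩ {x | x k ≤ m k B}) k
  have hA : ∀ k, c < μ (f '' A k) := by
    intro k
    induction k with
    | zero => simpa [A] using hc
    | succ k ih => exact hm k _ ih
  have hAb : ∀ k, A k = {x | ∀ i < k, x i ≤ m i (A i)} := by
    intro k
    induction k with
    | zero => simp [A]
    | succ k ih =>
      change A k ∩ {x | x k ≤ m k (A k)} = _
      ext x
      rw [Set.mem_inter_iff, Set.ext_iff.1 ih x]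
      simp only [Nat.lt_succ_iff_lt_or_eq, or_imp, forall_and, Set.mem_ofPred_eq, forall_eq]
  refine ⟨_, Set.image_subset_range f _, (isCompact_setOf_forall_le fun i => m i (A i)).image hf, ?_⟩
  -- An open set containing the image of the whole box already contains that of some `A k`, so its
  -- measure exceeds `c`.
  rw [Set.measure_eq_iInf_isOpen]
  refine le_iInf₂ fun U hU => le_iInf fun hUo => ?_
  obtain ⟨k, hk⟩ := exists_image_box_subset_of_isOpen hf (fun i => m i (A i)) hUo hU
  rw [← hAb k] at hk
  exact (hA k).le.trans (measure_mono hk)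

/-- Analytic sets are universally measurable. -/
theorem MeasureTheory.AnalyticSet.nullMeasurableSet {X : Type*} [TopologicalSpace X] [T2Space X]
    [MeasurableSpace X] [BorelSpace X] {s : Set X} (hs : AnalyticSet s) (μ : Measure X)
    [IsFiniteMeasure μ] [μ.OuterRegular] : NullMeasurableSet s μ := by
  rw [AnalyticSet] at hs
  obtain rfl | ⟨f, hf, rfl⟩ := hs
  · exact .empty
  obtain h0 | h0 := eq_or_ne (μ (Set.range f)) 0
  · exact .of_null h0
  obtain ⟨c, -, hc, hlim⟩ := exists_seq_strictMono_tendsto' (pos_iff_ne_zero.2 h0)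
  choose K hKs hK hcK using fun n => exists_isCompact_subset_range_lt_measure hf μ (hc n).2
  have hle : μ (Set.range f) ≤ μ (⋃ n, K n) :=
    le_of_tendsto' hlim fun n => (hcK n).trans (measure_mono (Set.subset_iUnion K n))
  have hmeas : MeasurableSet (⋃ n, K n) := .iUnion fun n => (hK n).measurableSet
  have hsub : ⋃ n, K n ⊆ Set.range f := Set.iUnion_subset hKs
  exact hmeas.nullMeasurableSet.congr
    (ae_eq_of_subset_of_measure_ge hsub hle hmeas.nullMeasurableSet (measure_ne_top _ _))

/-- Measurable images of measurable subsets of standard Borel spaces are universally measurable. -/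
theorem MeasurableSet.nullMeasurableSet_image {X Y : Type*} [MeasurableSpace X]
    [StandardBorelSpace X] [MeasurableSpace Y] [MeasurableSpace.CountablySeparated Y] {f : X → Y}
    {s : Set X} (hs : MeasurableSet s) (hf : Measurable f) (μ : Measure Y) [IsFiniteMeasure μ] :
    NullMeasurableSet (f '' s) μ := by
  obtain ⟨e, he, hinj⟩ := MeasurableSpace.measurable_injection_nat_bool_of_countablySeparated Y
  have h := (hs.analyticSet_image (he.comp hf)).nullMeasurableSet (μ.map e)
  have h' := h.preimage (he.quasiMeasurePreserving μ)
  rwa [Set.image_comp, Set.preimage_image_eq _ hinj] at h'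

instance SimpleGraph.countablySeparated {V : Type*} [Countable V] :
    MeasurableSpace.CountablySeparated (SimpleGraph V) := by
  have : MeasurableSpace.CountablyGenerated (SimpleGraph V) :=
    MeasurableSpace.CountablyGenerated.comap _
  have : MeasurableSpace.SeparatesPoints (SimpleGraph V) := by
    refine ⟨fun G H h => ?_⟩
    ext u v
    have hm : Measurable fun N : SimpleGraph V => N.Adj u v := by fun_prop
    exact ⟨h {N | N.Adj u v} hm.setOf, fun hH => by_contra fun hG =>
      h {N | ¬ N.Adj u v} hm.setOf.compl hG hH⟩
  infer_instance

/-- The graphs on `ℕ` isomorphic to `M` via an isomorphism that agrees with `τ` on `S` form a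
universally measurable set. -/
theorem SimpleGraph.nullMeasurableSet_iso_eqOn (M : SimpleGraph ℕ) (S : Set ℕ) (τ : ℕ → ℕ)
    (μ : Measure (SimpleGraph ℕ)) [IsFiniteMeasure μ] :
    NullMeasurableSet {N : SimpleGraph ℕ | ∃ f : N ≃g M, ∀ x ∈ S, f (τ x) = x} μ := by
  have hs : MeasurableSet {g : ℕ → ℕ | g.Bijective ∧ ∀ x ∈ S, g (τ x) = x} := by
    simp only [Function.Bijective, Function.Injective, Function.Surjective]
    measurability
  have hf : Measurable fun g : ℕ → ℕ => M.comap g := by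
    refine measurable_iff_adj.2 fun u v => ?_
    simp only [comap_adj]
    have : Measurable fun p : ℕ × ℕ => M.Adj p.1 p.2 := measurable_of_countable _
    exact this.comp (f := fun g : ℕ → ℕ => (g u, g v)) (by fun_prop)
  -- The copies of `M` on `ℕ` are its pullbacks along bijections, so the event is a measurable image
  -- of a Borel set in Baire space.
  convert hs.nullMeasurableSet_image hf μ using 1
  ext N
  constructor
  · rintro ⟨f, hf⟩
    exact ⟨f, ⟨f.bijective, hf⟩, by ext; exact f.map_rel_iff⟩
  · rintro ⟨g, ⟨hg, hgS⟩, rfl⟩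
    exact ⟨⟨Equiv.ofBijective g hg, by simp⟩, hgS⟩

/-! ### Exchangeability and trivial definable closure -/

theorem MeasureTheory.measurePreserving_comp_equiv_infinitePi {ι κ X : Type*} [MeasurableSpace X]
    (μ : Measure X) [IsProbabilityMeasure μ] (e : ι ≃ κ) :
    MeasurePreserving (fun x : κ → X => x ∘ e) (Measure.infinitePi fun _ => μ)
      (Measure.infinitePi fun _ => μ) := by
  refine ⟨by fun_prop, ?_⟩
  have h := Measure.infinitePi_map_piCongrLeft (fun _ : ι => μ) e.symm
  rw [← h]
  congr 1
  ext x i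
  simp [MeasurableEquiv.coe_piCongrLeft, Equiv.piCongrLeft]

/-- The equivalence of unordered pairs induced by an equivalence. -/
def Equiv.sym2Map {α β : Type*} (e : α ≃ β) : Sym2 α ≃ Sym2 β where
  toFun := Sym2.map e
  invFun := Sym2.map e.symm
  left_inv p := by simp [Sym2.map_map]
  right_inv p := by simp [Sym2.map_map]

theorem Graphon.measurePreserving_comap_randomGraph (W : Graphon) (τ : Equiv.Perm ℕ) :
    MeasurePreserving (fun N : SimpleGraph ℕ => N.comap τ) W.randomGraph W.randomGraph := by
  have hm : Measurable fun N : SimpleGraph ℕ => N.comap τ := by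
    refine SimpleGraph.measurable_iff_adj.2 fun u v => ?_
    simp only [SimpleGraph.comap_adj]
    fun_prop
  refine ⟨hm, ?_⟩
  have hp := (measurePreserving_comp_equiv_infinitePi (volume : Measure I) τ).prod
    (measurePreserving_comp_equiv_infinitePi (volume : Measure I) τ.sym2Map)
  rw [Graphon.randomGraph, Measure.map_map hm W.measurable_sampleGraph]
  conv_rhs => rw [← hp.map_eq, Measure.map_map W.measurable_sampleGraph hp.measurable]
  congr 1
  ext ω u v
  simp [Graphon.sampleGraph, Equiv.sym2Map]

/-- Double counting: the measures sum to the integral of the number of sets containing a point. -/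
theorem MeasureTheory.card_mul_le_of_forall_card_le {α ι : Type*} [MeasurableSpace α]
    (μ : Measure α) [IsProbabilityMeasure μ] {s : ι → Set α} (hs : ∀ i, NullMeasurableSet (s i) μ)
    {p : ENNReal} (J : Finset ι) (hp : ∀ i ∈ J, p ≤ μ (s i)) (r : ℕ)
    (hr : ∀ x, {i | x ∈ s i}.encard ≤ r) : J.card * p ≤ r := by
  classical
  calc (J.card : ENNReal) * p = ∑ i ∈ J, p := by simp
    _ ≤ ∑ i ∈ J, μ (s i) := Finset.sum_le_sum hp
    _ = ∑ i ∈ J, ∫⁻ x, (s i).indicator 1 x ∂μ :=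
      Finset.sum_congr rfl fun i _ => (lintegral_indicator_one₀ (hs i)).symm
    _ = ∫⁻ x, ∑ i ∈ J, (s i).indicator 1 x ∂μ :=
      (lintegral_finsetSum' _ fun i _ => aemeasurable_one.indicator₀ (hs i)).symm
    _ ≤ ∫⁻ _, r ∂μ := by
      refine lintegral_mono fun x => ?_
      have h1 : ∑ i ∈ J, (s i).indicator (1 : α → ENNReal) x = (J.filter (x ∈ s ·)).card := by
        simp [Set.indicator_apply, Finset.sum_boole]
      have h2 : ((J.filter (x ∈ s ·)).card : ℕ∞) ≤ r := by
        rw [← Set.encard_coe_eq_coe_finsetCard]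
        exact (Set.encard_mono fun i hi => by simpa using (Finset.mem_filter.1 hi).2).trans (hr x)
      simp only [h1]
      exact_mod_cast h2
    _ = r := by simp

/-- If the distribution of a `W`-random graph is concentrated on `M`, then `M` has trivial
group-theoretic definable closure. -/
theorem Graphon.exists_iso_fix_apply_notMem {W : Graphon} {M : SimpleGraph ℕ}
    (hW : IsConcentratedOn W.randomGraph M) (A B : Finset ℕ) {a : ℕ} (ha : a ∉ A) :
    ∃ g : M ≃g M, (∀ x ∈ A, g x = x) ∧ g a ∉ B := by
  classical
  by_contra! hcon
  let μ := W.randomGraph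
  let S : Finset ℕ := insert a A
  let E : (ℕ → ℕ) → Set (SimpleGraph ℕ) := fun τ => {N | ∃ f : N ≃g M, ∀ x ∈ S, f (τ x) = x}
  have hE : ∀ τ, NullMeasurableSet (E τ) μ := fun τ => M.nullMeasurableSet_iso_eqOn S τ μ
  have hinv : ∀ τ : Equiv.Perm ℕ, μ (E τ) = μ (E id) := by
    intro τ
    rw [← (W.measurePreserving_comap_randomGraph τ).measure_preimage (hE id)]
    congr 1
    ext N
    let c : N.comap τ ≃g N := SimpleGraph.Iso.comap τ N
    constructor
    · rintro ⟨f, hf⟩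
      exact ⟨f.comp c, hf⟩
    · rintro ⟨f, hf⟩
      refine ⟨f.comp c.symm, fun x hx => ?_⟩
      have : c.symm (τ x) = x := c.symm_apply_apply x
      simpa [this] using hf x hx
  have hpos : μ (E id) ≠ 0 := by
    intro h0
    -- `E τ` depends only on `τ` restricted to the finite set `S`, so countably many of these events
    -- cover the isomorphism class.
    have hcover : {N : SimpleGraph ℕ | Nonempty (N ≃g M)} ⊆
        ⋃ t : {t : S → ℕ | ∃ τ : Equiv.Perm ℕ, ∀ x : S, τ x = t x}, E t.2.choose := by
      rintro N ⟨f⟩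
      refine Set.mem_iUnion.2 ⟨⟨fun x => f.symm x, f.symm.toEquiv, fun x => rfl⟩, f, fun x hx => ?_⟩
      generalize_proofs h
      rw [h.choose_spec ⟨x, hx⟩]
      simp
    have : μ {N : SimpleGraph ℕ | Nonempty (N ≃g M)} = 0 :=
      measure_mono_null hcover (measure_iUnion_null fun t => by rw [hinv, h0])
    exact zero_ne_one (this.symm.trans hW)
  have hcard : ∀ J : Finset {j // j ∉ A}, J.card * μ (E id) ≤ B.card := by
    intro J
    refine card_mul_le_of_forall_card_le μ (s := fun j : {j // j ∉ A} => E (Equiv.swap a j))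
      (fun _ => hE _) J (fun j _ => (hinv _).ge) _ fun N => ?_
    have key : ∀ (j : {j // j ∉ A}) (f : N ≃g M), (∀ x ∈ S, f (Equiv.swap a j x) = x) →
        (∀ x ∈ A, f x = x) ∧ f j = a := by
      intro j f hf
      refine ⟨fun x hx => ?_, by simpa using hf a (by simp [S])⟩
      have := hf x (Finset.mem_insert_of_mem hx)
      rwa [Equiv.swap_apply_of_ne_of_ne (by rintro rfl; exact ha hx)
        (by rintro rfl; exact j.2 hx)] at this
    obtain h | ⟨j₀, f₀, hf₀⟩ := {j : {j // j ∉ A} | N ∈ E (Equiv.swap a j)}.eq_empty_or_nonempty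
    · simp [h]
    rw [← Set.encard_coe_eq_coe_finsetCard B]
    refine Set.encard_le_encard_of_injOn (f := fun j => f₀ j) ?_
      fun _ _ _ _ h => Subtype.ext (f₀.injective h)
    rintro j ⟨f, hf⟩
    obtain ⟨h1, h2⟩ := key j f hf
    obtain ⟨h3, -⟩ := key j₀ f₀ hf₀
    have hsymm : ∀ x y, f x = y → f.symm y = x := by rintro x _ rfl; simp
    -- This automorphism fixes `A` and sends `a` to `f₀ j`, so `f₀` injects the admissible `j` into
    -- `B`.
    have := hcon (f₀.comp f.symm) fun x hx => by simp [hsymm x x (h1 x hx), h3 x hx]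
    simpa [hsymm _ _ h2] using this
  have : Infinite {j // j ∉ A} := A.finite_toSet.infinite_compl.to_subtype
  have htop : μ (E id) ≠ ⊤ := measure_ne_top _ _
  obtain ⟨n, hn⟩ := ENNReal.exists_nat_mul_gt hpos (ENNReal.natCast_ne_top B.card)
  obtain ⟨J, hJ⟩ := Infinite.exists_subset_card_eq {j // j ∉ A} n
  exact absurd (hcard J) (by rw [hJ]; exact hn.not_ge)

/-! ### Duplicating finite sets of vertices -/

namespace SimpleGraph

variable {V : Type*} {M : SimpleGraph V}

/-- A graph has trivial group-theoretic definable closure if, for every finite set `A` of vertices,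
the vertices outside `A` have infinite orbits under the pointwise stabilizer of `A`. -/
def HasTrivialDCL (M : SimpleGraph V) : Prop :=
  ∀ (A B : Finset V) (a : V), a ∉ A → ∃ g : M ≃g M, (∀ x ∈ A, g x = x) ∧ g a ∉ B

/-- In a graph with trivial definable closure, all vertices of a finite set can be duplicated
simultaneously, so that replacing any of them by their duplicates is elementary. -/
theorem HasTrivialDCL.exists_duplicate [DecidableEq V] (hM : M.HasTrivialDCL) (A : Finset V) :
    ∃ h : V → V, Set.InjOn h A ∧ (∀ a ∈ A, h a ∉ A) ∧
      ∀ T ⊆ A, ∃ g : M ≃g M, ∀ a ∈ A, g a = if a ∈ T then h a else a := by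
  suffices H : ∀ S ⊆ A, ∃ h : V → V, Set.InjOn h S ∧ (∀ a ∈ S, h a ∉ A) ∧
      ∀ T ⊆ S, ∃ g : M ≃g M, ∀ a ∈ A, g a = if a ∈ T then h a else a from H A subset_rfl
  intro S
  induction S using Finset.induction_on with
  | empty =>
    refine fun _ => ⟨id, by simp, by simp, fun T hT => ⟨Iso.refl, fun a _ => ?_⟩⟩
    simp
  | insert s S hs ih =>
    intro hSA
    obtain ⟨hsA, hSA⟩ := Finset.insert_subset_iff.1 hSA
    obtain ⟨h, hinj, hA, hT⟩ := ih hSA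
    obtain ⟨g, hg, hgs⟩ := hM ((A ∪ S.image h).erase s) (A ∪ S.image h) s (by simp)
    have hne : ∀ a ∈ S, a ≠ s := by rintro a ha rfl; exact hs ha
    simp only [Finset.mem_union, Finset.mem_image, not_or, not_exists, not_and] at hgs
    refine ⟨Function.update h s (g s), ?_, ?_, ?_⟩
    · rw [Finset.coe_insert, Set.injOn_insert (by simpa using hs)]
      constructor
      · intro a ha b hb hab
        rw [Function.update_of_ne (hne a ha), Function.update_of_ne (hne b hb)] at hab
        exact hinj ha hb hab
      · rintro ⟨a, ha, hab⟩
        rw [Function.update_of_ne (hne a ha), Function.update_self] at hab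
        exact hgs.2 a ha hab
    · intro a ha
      obtain rfl | ha := Finset.mem_insert.1 ha
      · simpa using hgs.1
      · rw [Function.update_of_ne (hne a ha)]
        exact hA a ha
    · intro T hTS
      obtain ⟨f, hf⟩ := hT (T.erase s) (Finset.subset_insert_iff.1 hTS)
      have hf' : ∀ a ∈ A, a ≠ s → f a = if a ∈ T then Function.update h s (g s) a else a := by
        intro a ha has
        rw [hf a ha, Function.update_of_ne has]
        simp [has]
      have hfs : f s = s := by simpa using hf s hsA
      by_cases hsT : s ∈ T
      -- `f` duplicates `T.erase s` and fixes `s`; then `g` moves `s` to a fresh vertex and fixes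
      -- all other values of `f` on `A`.
      · refine ⟨g.comp f, fun a ha => ?_⟩
        change g (f a) = _
        obtain rfl | has := eq_or_ne a s
        · simp [hfs, hsT]
        · rw [← hf' a ha has]
          refine hg _ (Finset.mem_erase.2 ⟨fun e => has (f.injective (e.trans hfs.symm)), ?_⟩)
          rw [hf' a ha has]
          split_ifs with haT
          · rw [Function.update_of_ne has]
            refine Finset.mem_union_right _ (Finset.mem_image_of_mem _ ?_)
            exact (Finset.mem_insert.1 (hTS haT)).resolve_left has
          · exact Finset.mem_union_left _ ha
      · refine ⟨f, fun a ha => ?_⟩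
        obtain rfl | has := eq_or_ne a s
        · simp [hfs, hsT]
        · exact hf' a ha has

/-- Every partial elementary map of a finite set `A` extends to a finite set `B`, with values in
a finite set that depends only on `A` and `B`. -/
theorem exists_finset_forall_exists_iso_mem (M : SimpleGraph V) (A B : Finset V) :
    ∃ C : Finset V, A ⊆ C ∧ B ⊆ C ∧ ∀ g : M ≃g M, ∀ b ∈ B,
      ∃ g' : M ≃g M, (∀ x ∈ A, g x ∈ A → g' x = g x) ∧ g' b ∈ C := by
  classical
  -- `Φ g` records the part of `g` mapping `A` into `A`. There are finitely many such records, and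
  -- `invFun` picks one automorphism for each; `C` collects their values on `B`.
  let Φ : (M ≃g M) → A → Option A := fun g x => if h : g x ∈ A then some ⟨g x, h⟩ else none
  have hfin : Set.Finite (Set.range fun p : (A → Option A) × B => Function.invFun Φ p.1 p.2) :=
    Set.finite_range _
  refine ⟨A ∪ B ∪ hfin.toFinset, by grind, by grind, fun g b hb => ?_⟩
  refine ⟨Function.invFun Φ (Φ g), fun x hx hgx => ?_, Finset.mem_union_right _ ?_⟩
  · have h := congrFun (Function.invFun_eq (f := Φ) ⟨g, rfl⟩) ⟨x, hx⟩
    simp only [Φ, hgx, dif_pos] at h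
    split_ifs at h with h'
    simpa using h
  · exact hfin.mem_toFinset.2 ⟨(Φ g, ⟨b, hb⟩), rfl⟩

/-- An increasing sequence of finite sets exhausting the vertices of a graph on `ℕ`, in which the
vertices of each set have duplicates in the next one, and each set is closed under extending
partial elementary maps of the previous one. -/
structure DuplicationTower (M : SimpleGraph ℕ) where
  carrier : ℕ → Finset ℕ
  dup : ℕ → ℕ → ℕ
  carrier_subset_succ : ∀ n, carrier n ⊆ carrier (n + 1)
  mem_carrier_of_lt : ∀ n, ∀ b < n, b ∈ carrier (n + 1)
  dup_mem : ∀ n, ∀ a ∈ carrier n, dup n a ∈ carrier (n + 1)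
  dup_notMem : ∀ n, ∀ a ∈ carrier n, dup n a ∉ carrier n
  injOn_dup : ∀ n, Set.InjOn (dup n) (carrier n)
  exists_iso_dup : ∀ n, ∀ T ⊆ carrier n,
    ∃ g : M ≃g M, ∀ a ∈ carrier n, g a = if a ∈ T then dup n a else a
  exists_iso_mem : ∀ n (g : M ≃g M), ∀ b < n, ∃ g' : M ≃g M,
    (∀ x ∈ carrier n, g x ∈ carrier n ∪ (carrier n).image (dup n) → g' x = g x) ∧
      g' b ∈ carrier (n + 1)

theorem HasTrivialDCL.nonempty_duplicationTower {M : SimpleGraph ℕ} (hM : M.HasTrivialDCL) :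
    Nonempty (DuplicationTower M) := by
  choose d hinj hd hiso using fun A => hM.exists_duplicate A
  choose C hAC hBC hC using M.exists_finset_forall_exists_iso_mem
  let F : ℕ → Finset ℕ := fun n =>
    Nat.rec ∅ (fun n A => C (A ∪ A.image (d A)) (Finset.range n)) n
  have hF : ∀ n, F (n + 1) = C (F n ∪ (F n).image (d (F n))) (Finset.range n) := fun n => rfl
  refine ⟨⟨F, fun n => d (F n), fun n => ?_, fun n b hb => ?_, fun n a ha => ?_, fun n => hd _,
    fun n => hinj _, fun n => hiso _, fun n g b hb => ?_⟩⟩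
  · exact Finset.subset_union_left.trans (hAC _ _)
  · exact hBC _ _ (Finset.mem_range.2 hb)
  · exact hAC _ _ (Finset.mem_union_right _ (Finset.mem_image_of_mem _ ha))
  · obtain ⟨g', h1, h2⟩ := hC (F n ∪ (F n).image (d (F n))) _ g b (Finset.mem_range.2 hb)
    exact ⟨g', fun x hx => h1 x (Finset.mem_union_left _ hx), h2⟩

end SimpleGraph

/-! ### Walkers, their limiting adjacency, and the back-and-forth -/

namespace SimpleGraph

/-- Countable graphs with a back-and-forth system of finite partial isomorphisms are isomorphic. -/
theorem nonempty_iso_of_backAndForth {V W : Type*} [Countable V] [Countable W]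
    {N : SimpleGraph V} {M : SimpleGraph W} {P : Finset (V × W) → Prop} (hP : P ∅)
    (hinj : ∀ s, P s → ∀ p ∈ s, ∀ q ∈ s, p.1 = q.1 ↔ p.2 = q.2)
    (hadj : ∀ s, P s → ∀ p ∈ s, ∀ q ∈ s, N.Adj p.1 q.1 ↔ M.Adj p.2 q.2)
    (forth : ∀ s, P s → ∀ v, ∃ t, s ⊆ t ∧ P t ∧ ∃ w, (v, w) ∈ t)
    (back : ∀ s, P s → ∀ w, ∃ t, s ⊆ t ∧ P t ∧ ∃ v, (v, w) ∈ t) : Nonempty (N ≃g M) := by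
  have := Encodable.ofCountable (V ⊕ W)
  let 𝒟 : V ⊕ W → Order.Cofinal {s // P s} := Sum.elim
    (fun v => ⟨{s | ∃ w, (v, w) ∈ s.1}, fun s => by
      obtain ⟨t, hst, ht, hv⟩ := forth s.1 s.2 v
      exact ⟨⟨t, ht⟩, hv, hst⟩⟩)
    (fun w => ⟨{s | ∃ v, (v, w) ∈ s.1}, fun s => by
      obtain ⟨t, hst, ht, hw⟩ := back s.1 s.2 w
      exact ⟨⟨t, ht⟩, hw, hst⟩⟩)
  let J := Order.idealOfCofinals ⟨∅, hP⟩ 𝒟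
  have hf : ∀ v, ∃ w, ∃ s ∈ J, (v, w) ∈ s.1 := by
    intro v
    obtain ⟨s, ⟨w, hw⟩, hs⟩ := Order.cofinal_meets_idealOfCofinals ⟨∅, hP⟩ 𝒟 (.inl v)
    exact ⟨w, s, hs, hw⟩
  have hg : ∀ w, ∃ v, ∃ s ∈ J, (v, w) ∈ s.1 := by
    intro w
    obtain ⟨s, ⟨v, hv⟩, hs⟩ := Order.cofinal_meets_idealOfCofinals ⟨∅, hP⟩ 𝒟 (.inr w)
    exact ⟨v, s, hs, hv⟩
  have common : ∀ p q, (∃ s ∈ J, p ∈ s.1) → (∃ s ∈ J, q ∈ s.1) → ∃ s, P s ∧ p ∈ s ∧ q ∈ s := by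
    rintro p q ⟨s, hs, hp⟩ ⟨t, ht, hq⟩
    obtain ⟨r, -, hsr, htr⟩ := J.directed s hs t ht
    exact ⟨r.1, r.2, hsr hp, htr hq⟩
  choose f hf using hf
  choose g hg using hg
  refine ⟨⟨⟨f, g, fun v => ?_, fun w => ?_⟩, fun {v w} => ?_⟩⟩
  · obtain ⟨s, hs, h1, h2⟩ := common _ _ (hf v) (hg (f v))
    exact ((hinj s hs _ h1 _ h2).2 rfl).symm
  · obtain ⟨s, hs, h1, h2⟩ := common _ _ (hg w) (hf (g w))
    exact ((hinj s hs _ h1 _ h2).1 rfl).symm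
  · obtain ⟨s, hs, h1, h2⟩ := common _ _ (hf v) (hf w)
    exact (hadj s hs _ h1 _ h2).symm

namespace DuplicationTower

variable {M : SimpleGraph ℕ} (D : DuplicationTower M)

theorem monotone_carrier : Monotone D.carrier := monotone_nat_of_le_succ D.carrier_subset_succ

/-- The vertex occupied at time `n` by a walker that starts at `x.1` and, as soon as its position
has entered the tower, moves to the duplicate of its position at the times selected by `x.2`. -/
def position (x : ℕ × (ℕ → Bool)) : ℕ → ℕ
  | 0 => x.1
  | n + 1 => if position x n ∈ D.carrier n ∧ x.2 n then D.dup n (position x n) else position x n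

theorem position_mem_succ {x : ℕ × (ℕ → Bool)} {n : ℕ} (h : D.position x n ∈ D.carrier n) :
    D.position x (n + 1) ∈ D.carrier (n + 1) := by
  rw [position]
  split_ifs
  · exact D.dup_mem n _ h
  · exact D.carrier_subset_succ n h

theorem position_mem_of_le {x : ℕ × (ℕ → Bool)} {n m : ℕ} (h : D.position x n ∈ D.carrier n)
    (hnm : n ≤ m) : D.position x m ∈ D.carrier m := by
  induction m, hnm using Nat.le_induction with
  | base => exact h
  | succ m _ ih => exact D.position_mem_succ ih

theorem exists_position_mem (x : ℕ × (ℕ → Bool)) : ∃ n, D.position x n ∈ D.carrier n := by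
  by_contra! hcon
  have h : ∀ n, D.position x n = x.1 := by
    intro n
    induction n with
    | zero => rfl
    | succ n ih => rw [position, if_neg fun h => hcon n h.1, ih]
  exact hcon (x.1 + 1 + 1) (by rw [h]; exact D.mem_carrier_of_lt _ _ (Nat.lt_succ_self _))

theorem position_of_forall_false {x : ℕ × (ℕ → Bool)} {n : ℕ} (h : ∀ k < n, x.2 k = false) :
    D.position x n = x.1 := by
  induction n with
  | zero => rfl
  | succ n ih =>
    rw [position, if_neg (by simp [h n (Nat.lt_succ_self n)]),
      ih fun k hk => h k (hk.trans_le n.le_succ)]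

theorem exists_iso_position {ι : Type*} {X : ι → ℕ × (ℕ → Bool)} {s : Set ι} {n m : ℕ}
    (hnm : n ≤ m) (hmem : ∀ i ∈ s, D.position (X i) n ∈ D.carrier n)
    (hinj : Set.InjOn (fun i => D.position (X i) n) s) :
    ∃ g : M ≃g M, ∀ i ∈ s, g (D.position (X i) n) = D.position (X i) m := by
  classical
  induction m, hnm using Nat.le_induction with
  | base => exact ⟨Iso.refl, fun _ _ => rfl⟩
  | succ m hm ih =>
    obtain ⟨g, hg⟩ := ih
    have hmem' : ∀ i ∈ s, D.position (X i) m ∈ D.carrier m :=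
      fun i hi => D.position_mem_of_le (hmem i hi) hm
    obtain ⟨f, hf⟩ := D.exists_iso_dup m
      ((D.carrier m).filter fun a => ∃ i ∈ s, D.position (X i) m = a ∧ (X i).2 m)
      (Finset.filter_subset _ _)
    refine ⟨f.comp g, fun i hi => ?_⟩
    change f (g _) = _
    rw [hg i hi, hf _ (hmem' i hi), position]
    congr 1
    simp only [Finset.mem_filter, hmem' i hi, true_and, eq_iff_iff]
    refine ⟨?_, fun h => ⟨i, hi, rfl, h⟩⟩
    rintro ⟨j, hj, hji, h⟩
    rw [← hg i hi, ← hg j hj] at hji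
    rwa [← hinj hj hi (g.injective hji)]

theorem position_ne_of_le {x y : ℕ × (ℕ → Bool)} {n m : ℕ} (hnm : n ≤ m)
    (hx : D.position x n ∈ D.carrier n) (hy : D.position y n ∈ D.carrier n)
    (hxy : D.position x n ≠ D.position y n) : D.position x m ≠ D.position y m := by
  obtain ⟨g, hg⟩ := D.exists_iso_position (X := id) (s := {x, y}) hnm (by simp [hx, hy])
    (Set.injOn_pair.2 fun h => absurd h hxy)
  simp only [Set.mem_insert_iff, Set.mem_singleton_iff, forall_eq_or_imp, forall_eq, id] at hg
  rw [← hg.1, ← hg.2]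
  exact g.injective.ne hxy

/-- When both walkers are inside the tower and their coins differ, coinciding positions split: one
stays, the other jumps out of the carrier. Distinct positions stay distinct. -/
theorem eventually_position_ne {x y : ℕ × (ℕ → Bool)}
    (hxy : ∃ᶠ n in Filter.atTop, x.2 n ≠ y.2 n) :
    ∀ᶠ n in Filter.atTop, D.position x n ≠ D.position y n := by
  obtain ⟨a, ha⟩ := D.exists_position_mem x
  obtain ⟨b, hb⟩ := D.exists_position_mem y
  obtain ⟨n, hn, hne⟩ := Filter.frequently_atTop.1 hxy (max a b)
  have hx := D.position_mem_of_le ha ((le_max_left a b).trans hn)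
  have hy := D.position_mem_of_le hb ((le_max_right a b).trans hn)
  have key : D.position x (n + 1) ≠ D.position y (n + 1) := by
    by_cases h : D.position x n = D.position y n
    · rw [position, position, ← h]
      rw [← h] at hy
      have hd : D.dup n (D.position x n) ≠ D.position x n := fun e =>
        D.dup_notMem n _ hx (e.symm ▸ hx)
      cases hx2 : x.2 n <;> cases hy2 : y.2 n <;> simp_all [Ne.symm]
    · exact D.position_ne_of_le n.le_succ hx hy h
  filter_upwards [Filter.eventually_ge_atTop (n + 1)] with m hm
  exact D.position_ne_of_le hm (D.position_mem_succ hx) (D.position_mem_succ hy) key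

/-- Two walkers are adjacent if their positions are eventually adjacent. -/
def LimAdj (x y : ℕ × (ℕ → Bool)) : Prop :=
  ∀ᶠ n in Filter.atTop, M.Adj (D.position x n) (D.position y n)

theorem limAdj_comm {x y : ℕ × (ℕ → Bool)} : D.LimAdj x y ↔ D.LimAdj y x := by
  simp only [LimAdj, M.adj_comm]

theorem limAdj_iff {x y : ℕ × (ℕ → Bool)} {n : ℕ} (hx : D.position x n ∈ D.carrier n)
    (hy : D.position y n ∈ D.carrier n) (hxy : D.position x n ≠ D.position y n) :
    D.LimAdj x y ↔ M.Adj (D.position x n) (D.position y n) := by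
  have key : ∀ m ≥ n, M.Adj (D.position x m) (D.position y m) ↔
      M.Adj (D.position x n) (D.position y n) := by
    intro m hm
    obtain ⟨g, hg⟩ := D.exists_iso_position (X := id) (s := {x, y}) hm (by simp [hx, hy])
      (Set.injOn_pair.2 fun h => absurd h hxy)
    simp only [Set.mem_insert_iff, Set.mem_singleton_iff, forall_eq_or_imp, forall_eq, id] at hg
    rw [← hg.1, ← hg.2, g.map_adj_iff]
  rw [LimAdj, Filter.eventually_congr (Filter.eventually_atTop.2 ⟨n, key⟩)]
  exact Filter.eventually_const

theorem measurable_position (n : ℕ) : Measurable fun x => D.position x n := by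
  induction n with
  | zero => exact measurable_fst
  | succ n ih =>
    have h2 : Measurable fun x : ℕ × (ℕ → Bool) => x.2 n := by fun_prop
    refine Measurable.ite ?_ ((measurable_of_countable (D.dup n)).comp ih) ih
    exact (ih (MeasurableSet.of_discrete (s := ((D.carrier n : Finset ℕ) : Set ℕ)))).inter
      (h2 (measurableSet_singleton true))

theorem measurableSet_limAdj : MeasurableSet {p : (ℕ × (ℕ → Bool)) × (ℕ × (ℕ → Bool)) |
    D.LimAdj p.1 p.2} := by
  simp only [LimAdj, Filter.eventually_atTop]
  have h : ∀ n, MeasurableSet {p : (ℕ × (ℕ → Bool)) × (ℕ × (ℕ → Bool)) |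
      M.Adj (D.position p.1 n) (D.position p.2 n)} := by
    intro n
    have hM : Measurable fun p : ℕ × ℕ => M.Adj p.1 p.2 := measurable_of_countable _
    exact (hM.comp (((D.measurable_position n).comp measurable_fst).prodMk
      ((D.measurable_position n).comp measurable_snd))).setOf
  have : {p : (ℕ × (ℕ → Bool)) × (ℕ × (ℕ → Bool)) | ∃ a, ∀ b ≥ a,
      M.Adj (D.position p.1 b) (D.position p.2 b)} =
      ⋃ a, ⋂ b ≥ a, {p | M.Adj (D.position p.1 b) (D.position p.2 b)} := by
    ext
    simp
  rw [this]
  exact .iUnion fun a => .iInter fun b => .iInter fun _ => h b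

/-- A graph on an infinite sequence of walkers is isomorphic to `M`, provided that the walkers are
sufficiently generic. -/
theorem nonempty_iso {N : SimpleGraph ℕ} {X : ℕ → ℕ × (ℕ → Bool)}
    (hN : ∀ i j, i ≠ j → (N.Adj i j ↔ D.LimAdj (X i) (X j)))
    (hsep : ∀ i j, i ≠ j → ∃ᶠ n in Filter.atTop, (X i).2 n ≠ (X j).2 n)
    (hhit : ∀ c m, ∃ j, (X j).1 = c ∧ ∀ k < m, (X j).2 k = false) : Nonempty (N ≃g M) := by
  classical
  -- A finite partial map is admissible if at some time its walkers occupy distinct vertices of the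
  -- carrier and one automorphism sends these to the prescribed targets.
  let P : Finset (ℕ × ℕ) → Prop := fun s => ∃ (n : ℕ) (g : M ≃g M),
    (∀ p ∈ s, D.position (X p.1) n ∈ D.carrier n ∧ g (D.position (X p.1) n) = p.2) ∧
      ∀ p ∈ s, ∀ q ∈ s, p.1 ≠ q.1 → D.position (X p.1) n ≠ D.position (X q.1) n
  have hmono : ∀ {s : Finset (ℕ × ℕ)} {n m : ℕ} {g : M ≃g M}, n ≤ m →
      (∀ p ∈ s, D.position (X p.1) n ∈ D.carrier n ∧ g (D.position (X p.1) n) = p.2) →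
      (∀ p ∈ s, ∀ q ∈ s, p.1 ≠ q.1 → D.position (X p.1) n ≠ D.position (X q.1) n) →
      ∃ f : M ≃g M, ∀ p ∈ s, f (D.position (X p.1) n) = D.position (X p.1) m := by
    intro s n m g hnm h1 h2
    obtain ⟨f, hf⟩ := D.exists_iso_position (X := X) (s := Prod.fst '' (s : Set (ℕ × ℕ))) hnm
      (by rintro _ ⟨p, hp, rfl⟩; exact (h1 p hp).1)
      (by
        rintro _ ⟨p, hp, rfl⟩ _ ⟨q, hq, rfl⟩ h
        exact not_imp_comm.1 (h2 p hp q hq) (not_not.2 h))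
    exact ⟨f, fun p hp => hf _ ⟨p, hp, rfl⟩⟩
  refine nonempty_iso_of_backAndForth (P := P) ⟨0, Iso.refl, by simp, by simp⟩ ?_ ?_ ?_ ?_
  · rintro s ⟨n, g, h1, h2⟩ p hp q hq
    constructor
    · intro h
      rw [← (h1 p hp).2, ← (h1 q hq).2, h]
    · intro h
      by_contra hne
      rw [← (h1 p hp).2, ← (h1 q hq).2] at h
      exact h2 p hp q hq hne (g.injective h)
  · rintro s ⟨n, g, h1, h2⟩ p hp q hq
    by_cases h : p.1 = q.1
    · rw [← (h1 p hp).2, ← (h1 q hq).2, h]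
      simp
    · rw [hN _ _ h, D.limAdj_iff (h1 p hp).1 (h1 q hq).1 (h2 p hp q hq h), ← (h1 p hp).2,
        ← (h1 q hq).2, g.map_adj_iff]
  · rintro s ⟨n, g, h1, h2⟩ i
    by_cases hi : ∃ c, (i, c) ∈ s
    · exact ⟨s, subset_rfl, ⟨n, g, h1, h2⟩, hi⟩
    push Not at hi
    have hne : ∀ p ∈ s, p.1 ≠ i := by rintro ⟨_, c⟩ hp rfl; exact hi c hp
    obtain ⟨a, ha⟩ := D.exists_position_mem (X i)
    have hev : ∀ᶠ m in Filter.atTop, ∀ p ∈ s, D.position (X p.1) m ≠ D.position (X i) m :=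
      (Filter.eventually_all_finset s).2 fun p hp =>
        D.eventually_position_ne (hsep _ _ (hne p hp))
    obtain ⟨m, hm, hmn⟩ := (hev.and (Filter.eventually_ge_atTop (max a n))).exists
    have hnm := (le_max_right a n).trans hmn
    obtain ⟨f, hf⟩ := hmono hnm h1 h2
    refine ⟨insert (i, g (f.symm (D.position (X i) m))) s, Finset.subset_insert _ _,
      ⟨m, g.comp f.symm, ?_, ?_⟩, _, Finset.mem_insert_self _ _⟩
    · intro p hp
      obtain rfl | hp := Finset.mem_insert.1 hp
      · exact ⟨D.position_mem_of_le ha ((le_max_left a n).trans hmn), rfl⟩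
      · refine ⟨D.position_mem_of_le (h1 p hp).1 hnm, ?_⟩
        rw [← hf p hp, ← (h1 p hp).2]
        simp
    · have hold : ∀ p ∈ s, ∀ q ∈ s, p.1 ≠ q.1 → D.position (X p.1) m ≠ D.position (X q.1) m := by
        intro p hp q hq h
        rw [← hf p hp, ← hf q hq]
        exact f.injective.ne (h2 p hp q hq h)
      intro p hp q hq h
      obtain rfl | hp := Finset.mem_insert.1 hp <;> obtain rfl | hq := Finset.mem_insert.1 hq
      · exact absurd rfl h
      · exact (hm q hq).symm
      · exact hm p hp
      · exact hold p hp q hq h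
  · rintro s ⟨n, g, h1, h2⟩ c
    by_cases hc : ∃ i, (i, c) ∈ s
    · exact ⟨s, subset_rfl, ⟨n, g, h1, h2⟩, hc⟩
    push Not at hc
    obtain ⟨m, hm⟩ : ∃ m, m = max n (g.symm c + 1) := ⟨_, rfl⟩
    have hnm : n ≤ m := hm ▸ le_max_left _ _
    obtain ⟨f, hf⟩ := hmono (hnm.trans m.le_succ) h1 h2
    -- Back: `f` may send `g.symm c` outside the tower. The replacement `f'` moves the old walkers
    -- in the same way but lands in the carrier at time `m + 1`, where a walker idle until then can
    -- be waiting.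
    obtain ⟨f', hf', hcm⟩ := D.exists_iso_mem m f (g.symm c)
      (hm ▸ Nat.lt_of_succ_le (le_max_right _ _))
    have hf'' : ∀ p ∈ s, f' (D.position (X p.1) n) = D.position (X p.1) (m + 1) := by
      intro p hp
      rw [← hf p hp]
      refine hf' _ (D.monotone_carrier hnm (h1 p hp).1) ?_
      have hpm := D.position_mem_of_le (h1 p hp).1 hnm
      rw [hf p hp, position]
      split_ifs
      · exact Finset.mem_union_right _ (Finset.mem_image_of_mem _ hpm)
      · exact Finset.mem_union_left _ hpm
    obtain ⟨j, hj, hjm⟩ := hhit (f' (g.symm c)) (m + 1)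
    have hjpos : D.position (X j) (m + 1) = f' (g.symm c) := by
      rw [D.position_of_forall_false hjm, hj]
    have hne : ∀ p ∈ s, D.position (X p.1) (m + 1) ≠ D.position (X j) (m + 1) := by
      intro p hp h
      rw [← hf'' p hp, hjpos] at h
      have := congrArg g (f'.injective h)
      rw [(h1 p hp).2] at this
      simp only [RelIso.apply_symm_apply] at this
      exact hc p.1 (this ▸ hp)
    refine ⟨insert (j, c) s, Finset.subset_insert _ _,
      ⟨m + 1, g.comp f'.symm, ?_, ?_⟩, j, Finset.mem_insert_self _ _⟩
    · intro p hp
      obtain rfl | hp := Finset.mem_insert.1 hp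
      · refine ⟨hjpos ▸ hcm, ?_⟩
        simp [hjpos]
      · refine ⟨D.position_mem_of_le (h1 p hp).1 (hnm.trans m.le_succ), ?_⟩
        rw [← hf'' p hp, ← (h1 p hp).2]
        simp
    · intro p hp q hq h
      obtain rfl | hp := Finset.mem_insert.1 hp <;> obtain rfl | hq := Finset.mem_insert.1 hq
      · exact absurd rfl h
      · exact (hne q hq).symm
      · exact hne p hp
      · rw [← hf'' p hp, ← hf'' q hq]
        exact f'.injective.ne (h2 p hp q hq h)

end DuplicationTower

end SimpleGraph

/-! ### Almost sure genericity of independent walkers -/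

namespace MeasureTheory

theorem ae_infinitePi_exists_mem {X : Type*} [MeasurableSpace X] (μ : Measure X)
    [IsProbabilityMeasure μ] {s : Set X} (hs : MeasurableSet s) (h : μ s ≠ 0) :
    ∀ᵐ x ∂Measure.infinitePi fun _ : ℕ => μ, ∃ j, x j ∈ s := by
  rw [ae_iff]
  have hle : ∀ n : ℕ,
      Measure.infinitePi (fun _ : ℕ => μ) {x | ¬ ∃ j, x j ∈ s} ≤ μ sᶜ ^ n := by
    intro n
    have := Measure.infinitePi_pi (fun _ : ℕ => μ) (s := Finset.range n) (t := fun _ => sᶜ)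
      fun _ _ => hs.compl
    rw [Finset.prod_const, Finset.card_range] at this
    rw [← this]
    refine measure_mono fun x hx j _ => ?_
    exact not_exists.1 hx j
  have hlt : μ sᶜ < 1 := by
    rw [prob_compl_eq_one_sub hs]
    exact ENNReal.sub_lt_self ENNReal.one_ne_top one_ne_zero h
  exact le_antisymm (ge_of_tendsto' (ENNReal.tendsto_pow_atTop_nhds_zero_of_lt_one hlt) hle)
    zero_le

theorem map_pair_infinitePi {ι X : Type*} [MeasurableSpace X] (μ : Measure X)
    [IsProbabilityMeasure μ] {i j : ι} (hij : i ≠ j) :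
    MeasurePreserving (fun x : ι → X => (x i, x j)) (Measure.infinitePi fun _ => μ)
      (μ.prod μ) := by
  refine ⟨by fun_prop, ?_⟩
  have h := (ProbabilityTheory.iIndepFun_infinitePi (P := fun _ : ι => μ) (X := fun _ x => x)
    fun _ => measurable_id).indepFun hij
  rw [h.map_prod_eq_prod_map_map (measurable_pi_apply i).aemeasurable
    (measurable_pi_apply j).aemeasurable, Measure.infinitePi_map_eval,
    Measure.infinitePi_map_eval]

end MeasureTheory

/-- The distribution of a sequence of independent fair coin tosses. -/
noncomputable def coinMeasure : Measure (ℕ → Bool) :=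
  Measure.infinitePi fun _ => (PMF.uniformOfFintype Bool).toMeasure

instance : IsProbabilityMeasure coinMeasure := by unfold coinMeasure; infer_instance

theorem coinMeasure_pi (s : Finset ℕ) (x : ℕ → Bool) :
    coinMeasure {y | ∀ k ∈ s, y k = x k} = 2⁻¹ ^ s.card := by
  have h := Measure.infinitePi_pi (fun _ : ℕ => (PMF.uniformOfFintype Bool).toMeasure)
    (s := s) (t := fun k => {x k}) fun _ _ => measurableSet_singleton _
  simp only [PMF.toMeasure_apply_singleton _ _ (measurableSet_singleton _),
    PMF.uniformOfFintype_apply, Fintype.card_bool, Finset.prod_const] at h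
  exact h

/-- Agreement with a fixed sequence on `K` prescribed tosses has probability `2⁻¹ ^ K`; the tail
event is a countable union over starting times. -/
theorem coinMeasure_eventually_eq (x : ℕ → Bool) :
    coinMeasure {y | ∀ᶠ n in Filter.atTop, x n = y n} = 0 := by
  refine measure_mono_null (t := ⋃ N, {y | ∀ n ≥ N, x n = y n}) (fun y hy => ?_)
    (measure_iUnion_null fun N => ?_)
  · simpa using Filter.eventually_atTop.1 hy
  have hle : ∀ K : ℕ, coinMeasure {y | ∀ n ≥ N, x n = y n} ≤ 2⁻¹ ^ K := by
    intro K
    have h := coinMeasure_pi (Finset.Ico N (N + K)) x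
    rw [Nat.card_Ico, Nat.add_sub_cancel_left] at h
    rw [← h]
    exact measure_mono fun y hy k hk => (hy k (Finset.mem_Ico.1 hk).1).symm
  exact le_antisymm (ge_of_tendsto' (ENNReal.tendsto_pow_atTop_nhds_zero_of_lt_one (by simp)) hle)
    zero_le

/-- The distribution of a pair of a random natural number, each of which has positive probability,
and a sequence of independent fair coin tosses. -/
noncomputable def walkerMeasure : Measure (ℕ × (ℕ → Bool)) :=
  (ProbabilityTheory.poissonMeasure 1).prod coinMeasure

instance : IsProbabilityMeasure walkerMeasure := by unfold walkerMeasure; infer_instance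

theorem walkerMeasure_ne_zero (c m : ℕ) :
    walkerMeasure {p | p.1 = c ∧ ∀ k < m, p.2 k = false} ≠ 0 := by
  have h : {p : ℕ × (ℕ → Bool) | p.1 = c ∧ ∀ k < m, p.2 k = false} =
      {c} ×ˢ {y | ∀ k ∈ Finset.range m, y k = (fun _ => false) k} := by
    ext
    simp
  rw [h, walkerMeasure, Measure.prod_prod, coinMeasure_pi]
  refine mul_ne_zero ?_ (by simp)
  rw [ProbabilityTheory.poissonMeasure_singleton]
  simp only [ne_eq, ENNReal.ofReal_eq_zero, not_le]
  positivity

theorem ae_walkerMeasure_frequently_ne :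
    ∀ᵐ p ∂walkerMeasure.prod walkerMeasure, ∃ᶠ n in Filter.atTop, p.1.2 n ≠ p.2.2 n := by
  have hms : MeasurableSet {p : (ℕ × (ℕ → Bool)) × (ℕ × (ℕ → Bool)) |
      ¬ ∃ᶠ n in Filter.atTop, p.1.2 n ≠ p.2.2 n} := by
    have : {p : (ℕ × (ℕ → Bool)) × (ℕ × (ℕ → Bool)) |
      ¬ ∃ᶠ n in Filter.atTop, p.1.2 n ≠ p.2.2 n} = ⋃ a, ⋂ b ≥ a, {p | p.1.2 b = p.2.2 b} := by
      ext
      simp [Filter.eventually_atTop]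
    rw [this]
    exact .iUnion fun a => .iInter fun b => .iInter fun _ =>
      measurableSet_eq_fun (by fun_prop) (by fun_prop)
  rw [ae_iff, Measure.measure_prod_null hms]
  refine Filter.Eventually.of_forall fun p => ?_
  have h : Prod.mk p ⁻¹' {p : (ℕ × (ℕ → Bool)) × (ℕ × (ℕ → Bool)) |
      ¬ ∃ᶠ n in Filter.atTop, p.1.2 n ≠ p.2.2 n} =
      Set.univ ×ˢ {y | ∀ᶠ n in Filter.atTop, p.2 n = y n} := by
    ext
    simp
  change walkerMeasure (Prod.mk p ⁻¹' _) = 0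
  rw [h, walkerMeasure, Measure.prod_prod, coinMeasure_eventually_eq, mul_zero]

/-! ### Constructing the random-free graphon -/

/-- A graph on `ℕ` with trivial definable closure is almost surely isomorphic to the random graph
of some random-free graphon. -/
theorem SimpleGraph.HasTrivialDCL.exists_isRandomFree {M : SimpleGraph ℕ} (hM : M.HasTrivialDCL) :
    ∃ W : Graphon, W.IsRandomFree ∧ IsConcentratedOn W.randomGraph M := by
  classical
  obtain ⟨D⟩ := hM.nonempty_duplicationTower
  -- `φ` turns a uniform label into a random walker, so the graphon can live on `[0,1]`.
  obtain ⟨φ, hφ, hφν⟩ := walkerMeasure.exists_measurable_map_eq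
  have hφp : MeasurePreserving φ volume walkerMeasure := ⟨hφ, hφν⟩
  let W : Graphon :=
    { toFun := fun x y => if D.LimAdj (φ x) (φ y) then 1 else 0
      symm' := fun x y => by simp only [D.limAdj_comm]
      measurable' := Measurable.ite
        (D.measurableSet_limAdj.preimage (f := Prod.map φ φ) (hφ.prodMap hφ))
        measurable_const measurable_const }
  refine ⟨W, .of_forall fun p => (ite_eq_or_eq _ _ _).symm, ?_⟩
  have hlabel : ∀ᵐ x ∂Measure.infinitePi fun _ : ℕ => (volume : Measure I),
      (∀ i j, i ≠ j → ∃ᶠ n in Filter.atTop, (φ (x i)).2 n ≠ (φ (x j)).2 n) ∧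
        ∀ c m, ∃ j, (φ (x j)).1 = c ∧ ∀ k < m, (φ (x j)).2 k = false := by
    refine .and ?_ ?_
    · simp only [ae_all_iff]
      intro i j hij
      exact ((hφp.prod hφp).comp (map_pair_infinitePi volume hij)).quasiMeasurePreserving.ae
        ae_walkerMeasure_frequently_ne
    · simp only [ae_all_iff]
      intro c m
      have hms : MeasurableSet {p : ℕ × (ℕ → Bool) | p.1 = c ∧ ∀ k < m, p.2 k = false} := by
        measurability
      refine ae_infinitePi_exists_mem volume (hφ hms) ?_
      rw [hφp.measure_preimage hms.nullMeasurableSet]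
      exact walkerMeasure_ne_zero c m
  -- Edges are decided by a strict inequality, so an edge label equal to `1` would delete an edge
  -- where `W` is `1`.
  have hedge : ∀ᵐ u ∂Measure.infinitePi fun _ : Sym2 ℕ => (volume : Measure I), ∀ e, u e ≠ 1 := by
    rw [ae_all_iff]
    intro e
    exact (measurePreserving_eval_infinitePi (fun _ : Sym2 ℕ => (volume : Measure I))
      e).quasiMeasurePreserving.ae (p := fun x => x ≠ 1) (Measure.ae_ne volume 1)
  refine le_antisymm prob_le_one ?_
  -- This inequality holds for arbitrary sets, so the isomorphism class need not be shown measurable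
  -- here.
  refine le_trans ?_ (Measure.le_map_apply W.measurable_sampleGraph.aemeasurable _)
  rw [← measure_univ (μ := (Measure.infinitePi fun _ : ℕ => (volume : Measure I)).prod
    (Measure.infinitePi fun _ : Sym2 ℕ => (volume : Measure I)))]
  refine measure_mono_ae ?_
  filter_upwards [Measure.quasiMeasurePreserving_fst.ae hlabel,
    Measure.quasiMeasurePreserving_snd.ae hedge] with ω h1 h2 _
  refine D.nonempty_iso (X := fun i => φ (ω.1 i)) (fun i j hij => ?_) h1.1 h1.2
  change i ≠ j ∧ ω.2 s(i, j) < (if D.LimAdj (φ (ω.1 i)) (φ (ω.1 j)) then 1 else 0) ↔ _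
  split_ifs with h
  · simpa only [h, iff_true] using
      And.intro hij (lt_of_le_of_ne unitInterval.le_one' (h2 s(i, j)))
  · simp [h]

theorem IsConcentratedOn.congr_iso {V V' : Type*} {μ : Measure (SimpleGraph ℕ)} {M : SimpleGraph V}
    {M' : SimpleGraph V'} (e : M ≃g M') (h : IsConcentratedOn μ M) : IsConcentratedOn μ M' := by
  rw [IsConcentratedOn, ← h]
  congr 1
  ext N
  exact ⟨fun ⟨f⟩ => ⟨e.symm.comp f⟩, fun ⟨f⟩ => ⟨e.comp f⟩⟩

theorem mainTheorem9 {V : Type*} [Countable V] [Infinite V] (M : SimpleGraph V)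
    (hM : ∃ W : Graphon, IsConcentratedOn W.randomGraph M) :
    ∃ W' : Graphon, W'.IsRandomFree ∧ IsConcentratedOn W'.randomGraph M := by
  obtain ⟨W, hW⟩ := hM
  obtain ⟨e⟩ := nonempty_equiv_of_countable (α := V) (β := ℕ)
  let c := SimpleGraph.Iso.map e M
  have hdcl : (M.map e.toEmbedding).HasTrivialDCL := fun A B _ ha =>
    Graphon.exists_iso_fix_apply_notMem (hW.congr_iso c) A B ha
  obtain ⟨W', hrf, hW'⟩ := hdcl.exists_isRandomFree
  exact ⟨W', hrf, hW'.congr_iso c.symm⟩
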